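/- Call a category \(\mathbf X\) an (elementary) topos if it is finitely complete, cartesian closed and has a subobject classifier, i.e. a monomorphism \(t : 1\to\Omega\) from the terminal object such that for every monomorphism \(m : M\to X\) there is a unique \(\chi_m : X\to\Omega\) for which \(m\) is the pullback of \(t\) along \(\chi_m\). A commutative square is a Van Kampen square if it is a pushout and, in every commutative cube having it as bottom face and whose back and left faces (the two vertical faces over the pair of arrows being pushed out) are pullbacks, the top face is a pushout if and only if the front and right faces are pullbacks. A category is adhesive if pullbacks along monomorphisms exist, pushouts along monomorphisms exist (that is, for every monomorphism \(m : X\to Y\) and every arrow \(f : X\to Z\), the pushout of \(m\) and \(f\) exists), and all such pushouts are Van Kampen squares. Theorem. Every topos is an adhesive category. -/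

import Mathlib

open CategoryTheory CategoryTheory.Limits
universe v u

/-!
A subobject of `X` is a predicate `X ⟶ Ω`, and it is handled here through its generalized elements
(`Mem`, `predicate_ext`): direct images along monomorphisms with the Beck–Chevalley condition
(`comp_directImage`), and implication (`exists_implication`), are all the logic that is needed.

Pushouts exist by Paré's theorem: `A ↦ Ω ^ A` is a monadic functor `Cᵒᵖ ⥤ C`, because the
Beck–Chevalley condition makes the image of a coreflexive equalizer a split coequalizer
(`hasPushouts`).

Since `T ⊗ -` has a right adjoint, a pushout glues predicates uniquely, with any parameter object
`T`. Conversely this property characterizes pushouts (`isPushout_of_predicates`), since a topos is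
balanced. The van Kampen property is derived from this description. Pushouts are stable under
pullback (`isPushout_of_isPullback`), as a pullback of the square along `αZ : Z' ⟶ Z` embeds in its
product with `Z'`, and predicates on it can be moved there by direct image. For a pushout along a
monomorphism `f`, singletons in `Y` extend to the pushout by direct image along `f`, so the opposite
side `i` is monic and the square is a pullback (`mono_of_isPushout`, `isPullback_of_isPushout`).
From this the face of the cube over `i` is seen to be a pullback by comparing two subobjects of `Z'`
(`isPullback_right`). For the face over `h`, the comparison morphism to the pullback is epic by
stability, and monic by an argument gluing a suitable implication (`eq_of_comp_eq`); so it is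
invertible (`isPullback_left`).
-/

namespace CategoryTheory.Topos

open MonoidalCategory CartesianMonoidalCategory HasSubobjectClassifier

variable {C : Type u} [Category.{v} C]

lemma isPullback_of_existsUnique {P X Y Z : C} {fst : P ⟶ X} {snd : P ⟶ Y} {f : X ⟶ Z}
    {g : Y ⟶ Z} (w : fst ≫ f = snd ≫ g)
    (ex : ∀ ⦃T : C⦄ (x : T ⟶ X) (y : T ⟶ Y), x ≫ f = y ≫ g →
      ∃ p : T ⟶ P, p ≫ fst = x ∧ p ≫ snd = y)
    (uniq : ∀ ⦃T : C⦄ (p q : T ⟶ P), p ≫ fst = q ≫ fst → p ≫ snd = q ≫ snd → p = q) :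
    IsPullback fst snd f g :=
  ⟨⟨w⟩, ⟨PullbackCone.IsLimit.mk w
    (fun s ↦ (ex s.fst s.snd s.condition).choose)
    (fun s ↦ (ex s.fst s.snd s.condition).choose_spec.1)
    (fun s ↦ (ex s.fst s.snd s.condition).choose_spec.2)
    (fun s _ h₁ h₂ ↦ uniq _ _
      (h₁.trans (ex s.fst s.snd s.condition).choose_spec.1.symm)
      (h₂.trans (ex s.fst s.snd s.condition).choose_spec.2.symm))⟩⟩

lemma mono_fst_of_isPullback {P X Y Z : C} {fst : P ⟶ X} {snd : P ⟶ Y} {f : X ⟶ Z} {g : Y ⟶ Z}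
    (H : IsPullback fst snd f g) [Mono g] : Mono fst :=
  ⟨fun a b e ↦ H.hom_ext e ((cancel_mono g).1 (by
    rw [Category.assoc, Category.assoc, ← H.w, reassoc_of% e]))⟩

/-! ### Predicates and their generalized elements -/

section Classifier

variable [HasSubobjectClassifier C]

variable (C) in
/-- The predicate on `X` that holds everywhere. -/
noncomputable def verum (X : C) : X ⟶ Ω C := Subobject.Classifier.χ₀ _ X ≫ truth C

@[simp]
lemma comp_verum {X Y : C} (f : X ⟶ Y) : f ≫ verum C Y = verum C X := by
  unfold verum
  rw [← Category.assoc]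
  congr 1
  exact Subsingleton.elim _ _

/-- The generalized element `t` of `X` satisfies the predicate `φ`, that is, `t` factors through
the subobject of `X` classified by `φ`. -/
def Mem {T X : C} (t : T ⟶ X) (φ : X ⟶ Ω C) : Prop := t ≫ φ = verum C T

lemma mem_comp {T X Y : C} {t : T ⟶ X} {f : X ⟶ Y} {φ : Y ⟶ Ω C} :
    Mem t (f ≫ φ) ↔ Mem (t ≫ f) φ := by
  simp [Mem]

lemma Mem.comp {S T X : C} {t : T ⟶ X} {φ : X ⟶ Ω C} (h : Mem t φ) (s : S ⟶ T) :
    Mem (s ≫ t) φ := by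
  unfold Mem at *
  rw [Category.assoc, h, comp_verum]

lemma mem_verum {T X : C} (t : T ⟶ X) : Mem t (verum C X) := comp_verum t

lemma mem_χ {T U X : C} (m : U ⟶ X) [Mono m] {t : T ⟶ X} :
    Mem t (χ m) ↔ ∃ s, s ≫ m = t := by
  constructor
  · intro h
    exact ⟨(isPullback_χ m).lift t (Subobject.Classifier.χ₀ _ T) h, (isPullback_χ m).lift_fst _ _ _⟩
  · rintro ⟨s, rfl⟩
    rw [← mem_comp, HasSubobjectClassifier.comm]
    exact mem_verum s

variable [HasPullbacks C]

lemma exists_eq_χ {X : C} (φ : X ⟶ Ω C) : ∃ (U : C) (m : U ⟶ X) (_ : Mono m), φ = χ m :=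
  Subobject.Classifier.surjective_χ _ φ

/-- Predicates with the same generalized elements are equal; this is the uniqueness of
characteristic maps. -/
lemma predicate_ext {X : C} {φ ψ : X ⟶ Ω C}
    (h : ∀ ⦃T : C⦄ (t : T ⟶ X), Mem t φ ↔ Mem t ψ) : φ = ψ := by
  obtain ⟨U, m, _, rfl⟩ := exists_eq_χ φ
  refine (unique m ψ ?_).symm
  have hm : Mem m ψ := (h m).1 ((mem_χ m).2 ⟨𝟙 _, Category.id_comp _⟩)
  refine isPullback_of_existsUnique hm (fun T x y hxy ↦ ?_)
    fun T p q hpq _ ↦ (cancel_mono m).1 hpq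
  have hx : Mem x ψ := by
    rw [Mem, hxy]
    unfold verum
    congr 1
    exact Subsingleton.elim _ _
  obtain ⟨s, hs⟩ := (mem_χ m).1 ((h x).2 hx)
  exact ⟨s, hs, Subsingleton.elim _ _⟩

lemma eq_verum {X : C} {φ : X ⟶ Ω C} (h : ∀ ⦃T : C⦄ (t : T ⟶ X), Mem t φ) :
    φ = verum C X :=
  predicate_ext fun _ t ↦ ⟨fun _ ↦ mem_verum t, fun _ ↦ h t⟩

/-- The direct image of a predicate along a monomorphism `m`: it classifies the composite of the
subobject classified by `φ` with `m`. -/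
noncomputable def directImage {A B : C} (m : A ⟶ B) [Mono m] (φ : A ⟶ Ω C) : B ⟶ Ω C :=
  χ (pullback.fst φ (truth C) ≫ m)

lemma mem_directImage {A B T : C} (m : A ⟶ B) [Mono m] (φ : A ⟶ Ω C) {t : T ⟶ B} :
    Mem t (directImage m φ) ↔ ∃ s : T ⟶ A, s ≫ m = t ∧ Mem s φ := by
  rw [directImage, mem_χ]
  constructor
  · rintro ⟨s, rfl⟩
    refine ⟨s ≫ pullback.fst _ _, by simp, ?_⟩
    refine Mem.comp ?_ s
    rw [Mem, pullback.condition]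
    unfold verum
    congr 1
    exact Subsingleton.elim _ _
  · rintro ⟨s, rfl, hs⟩
    have hs' : s ≫ φ = Subobject.Classifier.χ₀ _ T ≫ truth C := hs
    exact ⟨pullback.lift s _ hs', by rw [pullback.lift_fst_assoc]⟩

/-- The Beck–Chevalley condition for direct images along monomorphisms. -/
lemma comp_directImage {A B A' B' : C} {k' : A' ⟶ A} {m' : A' ⟶ B'} {m : A ⟶ B} {k : B' ⟶ B}
    [Mono m] [Mono m'] (H : IsPullback k' m' m k) (φ : A ⟶ Ω C) :
    k ≫ directImage m φ = directImage m' (k' ≫ φ) := by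
  refine predicate_ext fun T t ↦ ?_
  rw [mem_comp, mem_directImage, mem_directImage]
  constructor
  · rintro ⟨s, hs, h⟩
    refine ⟨H.lift s t hs, H.lift_snd _ _ _, ?_⟩
    rwa [mem_comp, H.lift_fst]
  · rintro ⟨s, rfl, h⟩
    refine ⟨s ≫ k', ?_, mem_comp.1 h⟩
    rw [Category.assoc, H.w, Category.assoc]

lemma self_comp_directImage {A B : C} (m : A ⟶ B) [Mono m] (φ : A ⟶ Ω C) :
    m ≫ directImage m φ = φ := by
  rw [comp_directImage (k' := 𝟙 A) (m' := 𝟙 A) (IsKernelPair.id_of_mono m)]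
  refine predicate_ext fun T t ↦ ?_
  simp [mem_directImage]

/-- Implication of predicates, in its Kripke–Joyal description. It classifies the equalizer of `φ`
and `φ ∧ ψ`. -/
lemma exists_implication [HasEqualizers C] {X : C} (φ ψ : X ⟶ Ω C) :
    ∃ θ : X ⟶ Ω C, ∀ ⦃T : C⦄ (t : T ⟶ X),
      Mem t θ ↔ ∀ ⦃S : C⦄ (s : S ⟶ T), Mem (s ≫ t) φ → Mem (s ≫ t) ψ := by
  obtain ⟨U, m, _, rfl⟩ := exists_eq_χ φ
  -- `directImage m (m ≫ ψ)` is the conjunction of the predicates `χ m` and `ψ`.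
  have hmeet : ∀ ⦃T : C⦄ (t : T ⟶ X), Mem t (directImage m (m ≫ ψ)) ↔ Mem t (χ m) ∧ Mem t ψ := by
    intro T t
    rw [mem_directImage, mem_χ]
    constructor
    · rintro ⟨s, rfl, h⟩
      exact ⟨⟨s, rfl⟩, mem_comp.1 h⟩
    · rintro ⟨⟨s, rfl⟩, h⟩
      exact ⟨s, rfl, mem_comp.2 h⟩
  refine ⟨χ (equalizer.ι (χ m) (directImage m (m ≫ ψ))), fun T t ↦ ?_⟩
  rw [mem_χ]
  constructor
  · rintro ⟨l, rfl⟩ S s hs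
    refine ((hmeet _).1 ?_).2
    rw [← Category.assoc] at hs ⊢
    rw [← mem_comp, ← equalizer.condition, mem_comp]
    exact hs
  · intro h
    refine ⟨equalizer.lift t (predicate_ext fun S s ↦ ?_), equalizer.lift_ι _ _⟩
    rw [mem_comp, mem_comp, hmeet]
    exact ⟨fun hs ↦ ⟨hs, h s hs⟩, And.left⟩

omit [HasPullbacks C] in
lemma mem_χ_equalizer [HasEqualizers C] {T X Y : C} {a b : X ⟶ Y} {t : T ⟶ X} :
    Mem t (χ (equalizer.ι a b)) ↔ t ≫ a = t ≫ b := by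
  rw [mem_χ]
  constructor
  · rintro ⟨s, rfl⟩
    rw [Category.assoc, Category.assoc, equalizer.condition]
  · exact fun h ↦ ⟨equalizer.lift t h, equalizer.lift_ι _ _⟩

/-- A morphism is epic as soon as it factors through no proper subobject of its codomain. -/
lemma epi_of_predicates [HasEqualizers C] {X Y : C} {f : X ⟶ Y}
    (hf : ∀ φ : Y ⟶ Ω C, f ≫ φ = verum C X → φ = verum C Y) : Epi f :=
  ⟨fun a b e ↦ by
    have h : Mem (𝟙 Y) (χ (equalizer.ι a b)) := by
      rw [hf (χ (equalizer.ι a b)) (eq_verum fun T t ↦ by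
        rw [mem_comp, mem_χ_equalizer, Category.assoc, Category.assoc, e])]
      exact mem_verum _
    simpa using mem_χ_equalizer.1 h⟩

end Classifier

/-! ### Products with a parameter object, and graphs -/

section Graph

variable [CartesianMonoidalCategory C]

instance mono_lift_id {T X : C} (a : T ⟶ X) : Mono (lift (𝟙 T) a) :=
  ⟨fun u v h ↦ by simpa using h =≫ fst _ _⟩

instance mono_whiskerLeft (T : C) {X Y : C} (f : X ⟶ Y) [Mono f] : Mono (T ◁ f) :=
  ⟨fun u v h ↦ by
    ext
    · simpa using h =≫ fst _ _
    · rw [← cancel_mono f]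
      simpa using h =≫ snd _ _⟩

instance mono_whiskerRight {X Y : C} (f : X ⟶ Y) [Mono f] (T : C) : Mono (f ▷ T) :=
  ⟨fun u v h ↦ by
    ext
    · rw [← cancel_mono f]
      simpa using h =≫ fst _ _
    · simpa using h =≫ snd _ _⟩

lemma swap_comp_swap_comp {X Y Z : C} (φ : X ⊗ Y ⟶ Z) :
    lift (snd X Y) (fst X Y) ≫ lift (snd Y X) (fst Y X) ≫ φ = φ := by
  rw [← Category.assoc, show lift (snd X Y) (fst X Y) ≫ lift (snd Y X) (fst Y X) = 𝟙 _ by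
    ext <;> simp, Category.id_comp]

lemma isPullback_whiskerRight {A B A' B' : C} {k' : A' ⟶ A} {m' : A' ⟶ B'} {m : A ⟶ B}
    {k : B' ⟶ B} (H : IsPullback k' m' m k) (T : C) :
    IsPullback (k' ▷ T) (m' ▷ T) (m ▷ T) (k ▷ T) := by
  refine isPullback_of_existsUnique (by simp [← comp_whiskerRight, H.w])
    (fun S x y h ↦ ?_) fun S p q h₁ h₂ ↦ ?_
  · have h₁ := h =≫ fst _ _
    have h₂ := h =≫ snd _ _
    simp only [Category.assoc, whiskerRight_fst, whiskerRight_snd] at h₁ h₂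
    refine ⟨lift (H.lift (x ≫ fst _ _) (y ≫ fst _ _) (by simpa using h₁)) (x ≫ snd _ _), ?_, ?_⟩
    · ext <;> simp
    · ext <;> simp [h₂]
  · ext
    · exact H.hom_ext (by simpa using h₁ =≫ fst _ _) (by simpa using h₂ =≫ fst _ _)
    · simpa using h₁ =≫ snd _ _

lemma isPullback_whiskerRight_whiskerLeft {A B S T : C} (m : A ⟶ B) (f : S ⟶ T) :
    IsPullback (A ◁ f) (m ▷ S) (m ▷ T) (B ◁ f) := by
  refine isPullback_of_existsUnique (by rw [whisker_exchange])
    (fun S x y h ↦ ?_) fun S p q h₁ h₂ ↦ ?_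
  · have h₁ := h =≫ fst _ _
    have h₂ := h =≫ snd _ _
    simp only [Category.assoc, whiskerRight_fst, whiskerRight_snd, whiskerLeft_fst,
      whiskerLeft_snd] at h₁ h₂
    refine ⟨lift (x ≫ fst _ _) (y ≫ snd _ _), ?_, ?_⟩
    · ext <;> simp [h₂]
    · ext <;> simp [h₁]
  · ext
    · simpa using h₁ =≫ fst _ _
    · simpa using h₂ =≫ snd _ _

/-- If `k'` is the pullback of `k` along `α : B' ⟶ B`, then for every `n : T ⊗ B' ⟶ N` the morphism
`T ◁ k'` is the pullback of `N ◁ k` along `(n, α) : T ⊗ B' ⟶ N ⊗ B`. -/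
lemma isPullback_lift_whiskerLeft {A B A' B' T N : C} {k' : A' ⟶ B'} {α' : A' ⟶ A}
    {α : B' ⟶ B} {k : A ⟶ B} (H : IsPullback k' α' α k) (n : T ⊗ B' ⟶ N) :
    IsPullback (T ◁ k') (lift (T ◁ k' ≫ n) (snd _ _ ≫ α')) (lift n (snd _ _ ≫ α)) (N ◁ k) := by
  refine isPullback_of_existsUnique ?_ (fun S x y e ↦ ?_) fun S p q h₁ h₂ ↦ ?_
  · ext <;> simp [H.w]
  · have e₁ := e =≫ fst _ _
    have e₂ := e =≫ snd _ _
    simp only [Category.assoc, lift_fst, lift_snd, whiskerLeft_fst, whiskerLeft_snd] at e₁ e₂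
    let l := H.lift (x ≫ snd _ _) (y ≫ snd _ _) (by simpa using e₂)
    have hl : lift (x ≫ fst _ _) l ≫ T ◁ k' = x := by ext <;> simp [l]
    refine ⟨lift (x ≫ fst _ _) l, hl, ?_⟩
    ext
    · rw [Category.assoc, lift_fst, reassoc_of% hl, e₁]
    · simp [l]
  · ext
    · simpa using h₁ =≫ fst _ _
    · exact H.hom_ext (by simpa using h₁ =≫ snd _ _) (by simpa using h₂ =≫ snd _ _)

lemma mono_lift_of_isPullback {A B A' B' T N : C} {k' : A' ⟶ B'} {α' : A' ⟶ A}
    {α : B' ⟶ B} {k : A ⟶ B} (H : IsPullback k' α' α k) (n : T ⊗ B' ⟶ N)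
    [Mono (lift n (snd _ _ ≫ α))] : Mono (lift (T ◁ k' ≫ n) (snd _ _ ≫ α')) :=
  ⟨fun p q e ↦ (isPullback_lift_whiskerLeft H n).hom_ext
    ((cancel_mono (lift n (snd _ _ ≫ α))).1 (by
      simp only [Category.assoc, (isPullback_lift_whiskerLeft H n).w, reassoc_of% e])) e⟩

variable [HasSubobjectClassifier C]

/-- The generalized elements of the graph of `a`. With `t = 𝟙 T` this is the singleton of `a`,
viewed as a generalized element of `X` at stage `T`. -/
lemma mem_χ_graph {S T X : C} (a : T ⟶ X) {t : S ⟶ T} {x : S ⟶ X} :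
    Mem (lift t x) (χ (lift (𝟙 T) a)) ↔ x = t ≫ a := by
  rw [mem_χ]
  constructor
  · rintro ⟨s, hs⟩
    have h₁ := hs =≫ fst _ _
    have h₂ := hs =≫ snd _ _
    simp only [Category.assoc, lift_fst, lift_snd, Category.comp_id] at h₁ h₂
    rw [← h₂, h₁]
  · rintro rfl
    exact ⟨t, by simp [comp_lift]⟩

end Graph

/-! ### Power objects and the existence of pushouts -/

section PowerObject

variable [CartesianMonoidalCategory C] [MonoidalClosed C] [HasSubobjectClassifier C]

variable (C) in
/-- The contravariant power object functor `A ↦ Ω ^ A`. -/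
noncomputable abbrev power : Cᵒᵖ ⥤ C := MonoidalClosed.internalHom.flip.obj (Ω C)

/-- Generalized elements of a power object of `A` are predicates on `A` with a parameter. -/
noncomputable def powerHomEquiv {T : C} {A : Cᵒᵖ} :
    (T ⟶ (power C).obj A) ≃ (A.unop ⊗ T ⟶ Ω C) :=
  ((ihom.adjunction A.unop).homEquiv T (Ω C)).symm

lemma powerHomEquiv_comp {S T : C} {A : Cᵒᵖ} (s : S ⟶ T) (f : T ⟶ (power C).obj A) :
    powerHomEquiv (s ≫ f) = A.unop ◁ s ≫ powerHomEquiv f :=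
  MonoidalClosed.uncurry_natural_left _ _

lemma powerHomEquiv_comp_map {T : C} {A B : Cᵒᵖ} (f : T ⟶ (power C).obj A) (g : A ⟶ B) :
    powerHomEquiv (f ≫ (power C).map g) = g.unop ▷ T ≫ powerHomEquiv f :=
  MonoidalClosed.uncurry_pre_app (Ω C) f g.unop

lemma powerHomEquiv_eq_comp {T : C} {A : Cᵒᵖ} (f : T ⟶ (power C).obj A) :
    powerHomEquiv f = A.unop ◁ f ≫ powerHomEquiv (𝟙 _) := by
  rw [← powerHomEquiv_comp, Category.comp_id]

variable (C) in
/-- The power object functor is adjoint to its own opposite: both `T ⟶ Ω ^ A` and `A ⟶ Ω ^ T`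
amount to relations between `A` and `T`. -/
noncomputable def powerAdjunction : (power C).rightOp ⊣ power C :=
  Adjunction.mkOfHomEquiv
    { homEquiv := fun T X ↦
        { toFun := fun f ↦ powerHomEquiv.symm
            (lift (snd _ _) (fst _ _) ≫ powerHomEquiv (A := .op T) f.unop)
          invFun := fun f ↦ (powerHomEquiv (A := .op T).symm
            (lift (snd _ _) (fst _ _) ≫ powerHomEquiv f)).op
          left_inv := fun f ↦ by
            apply Quiver.Hom.unop_inj
            apply (powerHomEquiv (A := .op T)).injective
            simp [swap_comp_swap_comp]
          right_inv := fun f ↦ by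
            apply powerHomEquiv.injective
            simp [swap_comp_swap_comp] }
      homEquiv_naturality_left_symm := fun {T' T X} f g ↦ by
        apply Quiver.Hom.unop_inj
        apply (powerHomEquiv (A := .op T')).injective
        refine (Equiv.apply_symm_apply _ _).trans ?_
        refine Eq.trans ?_ (powerHomEquiv_comp_map _ f.op).symm
        dsimp
        rw [Equiv.apply_symm_apply, powerHomEquiv_comp]
        simp only [← Category.assoc]
        congr 1
        ext <;> simp
      homEquiv_naturality_right := fun {T X X'} f g ↦ by
        apply powerHomEquiv.injective
        refine (Equiv.apply_symm_apply _ _).trans ?_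
        refine Eq.trans ?_ (powerHomEquiv_comp_map _ g).symm
        refine (congrArg (_ ≫ ·) (powerHomEquiv_comp (A := .op T) g.unop f.unop)).trans ?_
        dsimp
        rw [Equiv.apply_symm_apply]
        simp only [← Category.assoc]
        congr 1
        ext <;> simp }

instance power_faithful : (power C).Faithful where
  map_injective {A B} f g h := by
    apply Quiver.Hom.unop_inj
    -- Evaluating at the equality predicate `δ` recovers a morphism from its action on power objects.
    let δ : A.unop ⊗ A.unop ⟶ Ω C := χ (lift (𝟙 A.unop) (𝟙 A.unop))
    have key := congr(powerHomEquiv (powerHomEquiv.symm δ ≫ $h))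
    rw [powerHomEquiv_comp_map, powerHomEquiv_comp_map, Equiv.apply_symm_apply] at key
    have h₁ : Mem (lift (𝟙 B.unop) f.unop) (f.unop ▷ A.unop ≫ δ) := by
      rw [mem_comp, lift_whiskerRight, mem_χ_graph]
      simp
    rw [key, mem_comp, lift_whiskerRight, mem_χ_graph] at h₁
    simpa using h₁

variable [HasPullbacks C]

/-- The covariant action of a monomorphism on power objects, taking subobjects to their images. -/
noncomputable def powerImage {A B : C} (m : A ⟶ B) [Mono m] :
    (power C).obj (.op A) ⟶ (power C).obj (.op B) :=
  powerHomEquiv.symm (directImage (m ▷ _) (powerHomEquiv (𝟙 _)))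

/-- The Beck–Chevalley condition on power objects. -/
lemma powerImage_comp_map {A B A' B' : C} {k' : A' ⟶ A} {m' : A' ⟶ B'} {m : A ⟶ B} {k : B' ⟶ B}
    [Mono m] [Mono m'] (H : IsPullback k' m' m k) :
    powerImage m ≫ (power C).map k.op = (power C).map k'.op ≫ powerImage m' := by
  apply powerHomEquiv.injective
  rw [powerHomEquiv_comp_map, powerHomEquiv_comp, powerImage, powerImage, Equiv.apply_symm_apply,
    Equiv.apply_symm_apply]
  dsimp only [Quiver.Hom.unop_op]
  rw [comp_directImage (isPullback_whiskerRight H _),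
    comp_directImage (isPullback_whiskerRight_whiskerLeft m' _)]
  congr 1
  rw [← powerHomEquiv_eq_comp]
  conv_rhs => rw [← Category.id_comp ((power C).map k'.op)]
  exact (powerHomEquiv_comp_map _ _).symm

lemma powerImage_comp_map_self {A B : C} (m : A ⟶ B) [Mono m] :
    powerImage m ≫ (power C).map m.op = 𝟙 _ := by
  apply powerHomEquiv.injective
  rw [powerHomEquiv_comp_map, powerImage, Equiv.apply_symm_apply]
  exact self_comp_directImage _ _

end PowerObject

/-- Paré's theorem, for pushouts: the power object functor `Cᵒᵖ ⥤ C` is monadic, so it creates the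
pullbacks of `Cᵒᵖ`, which are the pushouts of `C`. -/
instance hasPushouts [HasFiniteLimits C] [CartesianMonoidalCategory C] [MonoidalClosed C]
    [HasSubobjectClassifier C] : HasPushouts C := by
  have : Monad.PreservesColimitOfIsReflexivePair (power C) := ⟨fun A B f g _ ↦ by
    -- The reflexive pair `f, g` of `Cᵒᵖ` is a coreflexive pair in `C`; the power object functor
    -- turns its equalizer `e` into a coequalizer split by direct images.
    let e := equalizer.ι f.unop g.unop
    let s := (commonSection f g).unop
    have hf : f.unop ≫ s = 𝟙 _ := congr(Quiver.Hom.unop $(section_comp_left f g))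
    have hg : g.unop ≫ s = 𝟙 _ := congr(Quiver.Hom.unop $(section_comp_right f g))
    have : Mono g.unop := (SplitMono.mk s hg).mono
    -- The common retraction `s` makes the equalizer the intersection of `f` and `g`.
    have he : IsPullback e e g.unop f.unop := by
      refine isPullback_of_existsUnique (equalizer.condition _ _).symm (fun T x y h ↦ ?_)
        fun T p q h _ ↦ (cancel_mono e).1 h
      have hxy : x = y := by simpa [hf, hg] using h =≫ s
      subst hxy
      exact ⟨equalizer.lift x h.symm, equalizer.lift_ι _ _, equalizer.lift_ι _ _⟩
    have w : f ≫ e.op = g ≫ e.op := Quiver.Hom.unop_inj (equalizer.condition f.unop g.unop)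
    have hc : IsColimit (Cofork.ofπ e.op w) :=
      Cofork.IsColimit.mk _
        (fun t ↦ (equalizer.lift t.π.unop congr(Quiver.Hom.unop $(t.condition))).op)
        (fun t ↦ Quiver.Hom.unop_inj (equalizer.lift_ι _ _))
        (fun t m hm ↦ Quiver.Hom.unop_inj
          ((cancel_mono e).1 (congr(Quiver.Hom.unop $hm).trans (equalizer.lift_ι _ _).symm)))
    let hs : IsSplitCoequalizer ((power C).map f) ((power C).map g) ((power C).map e.op) :=
      { rightSection := powerImage e
        leftSection := powerImage g.unop
        condition := by rw [← Functor.map_comp, w, Functor.map_comp]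
        rightSection_π := powerImage_comp_map_self e
        leftSection_bottom := powerImage_comp_map_self g.unop
        leftSection_top := powerImage_comp_map he }
    exact preservesColimit_of_preserves_colimit_cocone hc
      ((isColimitMapCoconeCoforkEquiv (power C) w).symm hs.isCoequalizer)⟩
  have : HasReflexiveCoequalizers Cᵒᵖ := inferInstance
  let := Monad.monadicOfHasPreservesReflexiveCoequalizersOfReflectsIsomorphisms (powerAdjunction C)
  have : CreatesLimitsOfSize.{0, 0} (power C) := monadicCreatesLimits (power C)
  have : HasPullbacks Cᵒᵖ := ⟨fun F ↦ hasLimit_of_created F (power C)⟩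
  have : HasPushouts Cᵒᵖᵒᵖ := inferInstance
  exact Adjunction.hasColimitsOfShape_of_equivalence (opOpEquivalence C).inverse

/-! ### Pushouts and predicates -/

section Pushout

variable {W X Y Z : C} {f : W ⟶ X} {g : W ⟶ Y} {h : X ⟶ Z} {i : Y ⟶ Z}

lemma exists_predicate [HasSubobjectClassifier C] (H : IsPushout f g h i) {φ : X ⟶ Ω C}
    {ψ : Y ⟶ Ω C} (w : f ≫ φ = g ≫ ψ) : ∃ θ : Z ⟶ Ω C, h ≫ θ = φ ∧ i ≫ θ = ψ :=
  ⟨H.desc φ ψ w, H.inl_desc _ _ _, H.inr_desc _ _ _⟩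

variable [CartesianMonoidalCategory C] [MonoidalClosed C]

lemma isPushout_whiskerLeft (H : IsPushout f g h i) (T : C) :
    IsPushout (T ◁ f) (T ◁ g) (T ◁ h) (T ◁ i) :=
  H.map (tensorLeft T)

variable [HasSubobjectClassifier C] [HasFiniteLimits C]

/-- A commutative square is a pushout if, with an arbitrary parameter object `T`, it glues
predicates uniquely. The comparison morphism `d` from the pushout is then monic, because the
singletons of generalized elements of the pushout are restrictions of predicates along `d`, and
epic, because it factors through no proper subobject. -/
lemma isPushout_of_predicates (sq : CommSq f g h i)
    (ex : ∀ (T : C) (φ : T ⊗ X ⟶ Ω C) (ψ : T ⊗ Y ⟶ Ω C), T ◁ f ≫ φ = T ◁ g ≫ ψ →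
      ∃ θ : T ⊗ Z ⟶ Ω C, T ◁ h ≫ θ = φ ∧ T ◁ i ≫ θ = ψ)
    (uniq : ∀ (T : C) (θ θ' : T ⊗ Z ⟶ Ω C), T ◁ h ≫ θ = T ◁ h ≫ θ' →
      T ◁ i ≫ θ = T ◁ i ≫ θ' → θ = θ') : IsPushout f g h i := by
  have H := IsPushout.of_hasPushout f g
  let d : pushout f g ⟶ Z := pushout.desc h i sq.w
  have hd₁ : pushout.inl f g ≫ d = h := pushout.inl_desc _ _ _
  have hd₂ : pushout.inr f g ≫ d = i := pushout.inr_desc _ _ _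
  have : Mono d := ⟨fun {T} a b hab ↦ by
    let φ : T ⊗ pushout f g ⟶ Ω C := χ (lift (𝟙 T) a)
    obtain ⟨θ, h₁, h₂⟩ := ex T (T ◁ pushout.inl f g ≫ φ) (T ◁ pushout.inr f g ≫ φ) (by
      rw [← whiskerLeft_comp_assoc, pushout.condition, whiskerLeft_comp_assoc])
    have hθ : T ◁ d ≫ θ = φ := by
      refine (isPushout_whiskerLeft H T).hom_ext ?_ ?_
      · rw [← whiskerLeft_comp_assoc, hd₁, h₁]
      · rw [← whiskerLeft_comp_assoc, hd₂, h₂]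
    have ha : Mem (lift (𝟙 T) a) φ := (mem_χ_graph a).2 (Category.id_comp a).symm
    rw [← hθ, mem_comp, lift_whiskerLeft, hab, ← lift_whiskerLeft, ← mem_comp, hθ,
      mem_χ_graph, Category.id_comp] at ha
    exact ha.symm⟩
  have : Epi d := epi_of_predicates fun φ hφ ↦ by
    have h₁ : h ≫ φ = verum C _ := by rw [← hd₁, Category.assoc, hφ, comp_verum]
    have h₂ : i ≫ φ = verum C _ := by rw [← hd₂, Category.assoc, hφ, comp_verum]
    -- `uniq` concerns predicates on products: `φ` is the restriction of the predicate
    -- `snd Z Z ≫ φ` on `Z ⊗ Z` along the diagonal.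
    have key : snd Z Z ≫ φ = verum C _ := by
      refine uniq Z _ _ ?_ ?_
      · rw [whiskerLeft_snd_assoc, h₁, comp_verum, comp_verum]
      · rw [whiskerLeft_snd_assoc, h₂, comp_verum, comp_verum]
    have := lift (𝟙 Z) (𝟙 Z) ≫= key
    rwa [lift_snd_assoc, Category.id_comp, comp_verum] at this
  have : IsIso d := isIso_of_mono_of_epi d
  exact H.of_iso (Iso.refl _) (Iso.refl _) (Iso.refl _) (asIso d) (by simp) (by simp)
    (by simp [hd₁]) (by simp [hd₂])

variable {W' X' Y' Z' : C} {f' : W' ⟶ X'} {g' : W' ⟶ Y'} {h' : X' ⟶ Z'} {i' : Y' ⟶ Z'}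
  {αW : W' ⟶ W} {αX : X' ⟶ X} {αY : Y' ⟶ Y} {αZ : Z' ⟶ Z}

/-- Pushouts are stable under pullback. With a parameter `T` and `N = T ⊗ Z'`, predicates on the
corners of `T ◁ -` applied to the upper square are moved to the corners of `N ◁ -` applied to the
lower pushout by direct image along the monomorphisms `(T ◁ h', αX)`, `(T ◁ i', αY)`, and so on;
they are glued there, and restricted back along `m = (𝟙, αZ) : N ⟶ N ⊗ Z`. -/
theorem isPushout_of_isPullback (H : IsPushout f g h i) (hf : IsPullback f' αW αX f)
    (hg : IsPullback g' αW αY g) (hh : IsPullback h' αX αZ h) (hi : IsPullback i' αY αZ i)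
    (sq : CommSq f' g' h' i') : IsPushout f' g' h' i' := by
  refine isPushout_of_predicates sq (fun T φ ψ w ↦ ?_) fun T θ θ' h₁ h₂ ↦ ?_
  all_goals
    have HT := isPushout_whiskerLeft H (T ⊗ Z')
    let m := lift (𝟙 (T ⊗ Z')) (snd T Z' ≫ αZ)
    have := mono_lift_of_isPullback hh (𝟙 (T ⊗ Z'))
    have := mono_lift_of_isPullback hi (𝟙 (T ⊗ Z'))
    have pX := isPullback_lift_whiskerLeft hh (𝟙 (T ⊗ Z'))
    have pY := isPullback_lift_whiskerLeft hi (𝟙 (T ⊗ Z'))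
  · have := mono_lift_of_isPullback hf (T ◁ h' ≫ 𝟙 (T ⊗ Z'))
    have pf := isPullback_lift_whiskerLeft hf (T ◁ h' ≫ 𝟙 (T ⊗ Z'))
    have pg := isPullback_lift_whiskerLeft hg (T ◁ i' ≫ 𝟙 (T ⊗ Z'))
    rw [← whiskerLeft_comp_assoc, ← sq.w, whiskerLeft_comp_assoc] at pg
    obtain ⟨θ, h₁, h₂⟩ := exists_predicate HT
      (φ := directImage (lift (T ◁ h' ≫ 𝟙 (T ⊗ Z')) (snd T X' ≫ αX)) φ)
      (ψ := directImage (lift (T ◁ i' ≫ 𝟙 (T ⊗ Z')) (snd T Y' ≫ αY)) ψ) (by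
        rw [comp_directImage pf, comp_directImage pg, w])
    refine ⟨m ≫ θ, ?_, ?_⟩
    · exact (pX.w_assoc θ).trans (by rw [h₁, self_comp_directImage])
    · exact (pY.w_assoc θ).trans (by rw [h₂, self_comp_directImage])
  · rw [← self_comp_directImage m θ, ← self_comp_directImage m θ']
    congr 1
    refine HT.hom_ext ?_ ?_
    · rw [comp_directImage pX, comp_directImage pX, h₁]
    · rw [comp_directImage pY, comp_directImage pY, h₂]

/-- If `f` is monic, the singleton of a generalized element `y` of `Y` extends to a predicate on the
pushout, by its direct image along `f` on the part `X`. -/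
lemma exists_predicate_singleton (H : IsPushout f g h i) [Mono f] {T : C} (y : T ⟶ Y) :
    ∃ θ : T ⊗ Z ⟶ Ω C,
      (∀ y' : T ⟶ Y, Mem (lift (𝟙 T) (y' ≫ i)) θ ↔ y' = y) ∧
      ∀ x : T ⟶ X, Mem (lift (𝟙 T) (x ≫ h)) θ → ∃ w : T ⟶ W, w ≫ f = x ∧ w ≫ g = y := by
  obtain ⟨θ, h₁, h₂⟩ := exists_predicate (isPushout_whiskerLeft H T)
    (φ := directImage (T ◁ f) (T ◁ g ≫ χ (lift (𝟙 T) y))) (ψ := χ (lift (𝟙 T) y))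
    (self_comp_directImage _ _)
  refine ⟨θ, fun y' ↦ ?_, fun x hx ↦ ?_⟩
  · rw [← lift_whiskerLeft, ← mem_comp, h₂, mem_χ_graph, Category.id_comp]
  · rw [← lift_whiskerLeft, ← mem_comp, h₁, mem_directImage] at hx
    obtain ⟨s, hs, hm⟩ := hx
    have e₁ := hs =≫ fst _ _
    have e₂ := hs =≫ snd _ _
    simp only [Category.assoc, lift_fst, lift_snd, whiskerLeft_fst, whiskerLeft_snd] at e₁ e₂
    have hs' : s = lift (𝟙 T) (s ≫ snd _ _) := by ext <;> simp [e₁]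
    rw [hs', mem_comp, lift_whiskerLeft, mem_χ_graph, Category.id_comp] at hm
    exact ⟨s ≫ snd _ _, by rw [Category.assoc, e₂], hm⟩

lemma mono_of_isPushout (H : IsPushout f g h i) [Mono f] : Mono i :=
  ⟨fun a b hab ↦ by
    obtain ⟨θ, h₁, -⟩ := exists_predicate_singleton H b
    exact (h₁ a).1 (hab ▸ (h₁ b).2 rfl)⟩

lemma isPullback_of_isPushout (H : IsPushout f g h i) [Mono f] : IsPullback f g h i := by
  refine isPullback_of_existsUnique H.w (fun T x y e ↦ ?_) fun T p q hpq _ ↦ (cancel_mono f).1 hpq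
  obtain ⟨θ, h₁, h₂⟩ := exists_predicate_singleton H y
  exact h₂ x (e ▸ (h₁ y).2 rfl)

/-! ### Faces of a cube over a pushout along a monomorphism -/

/-- In a cube over a pushout along a monomorphism, with pullbacks as back faces and a pushout on
top, the face over `i` is a pullback: `i'` and the pullback of `i` along `αZ` define the same
subobject of `Z'`, as they agree on `X'` and on `Y'`. -/
lemma isPullback_right (H : IsPushout f g h i) [Mono f] (hf : IsPullback f' αW αX f)
    (hh : CommSq h' αX αZ h) (hi : CommSq i' αY αZ i)
    (H' : IsPushout f' g' h' i') : IsPullback i' αY αZ i := by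
  have := mono_fst_of_isPullback hf
  have := mono_of_isPushout H
  have := mono_of_isPushout H'
  have key : αZ ≫ χ i = χ i' := by
    refine H'.hom_ext (predicate_ext fun T t ↦ ?_) ?_
    · simp only [mem_comp, mem_χ, Category.assoc, hh.w]
      constructor
      · rintro ⟨y, hy⟩
        obtain ⟨w, h₁, -⟩ := (isPullback_of_isPushout H).exists_lift (t ≫ αX) y (by simp [hy])
        obtain ⟨w', h₁', -⟩ := hf.exists_lift t w h₁.symm
        exact ⟨w' ≫ g', by rw [Category.assoc, ← H'.w, reassoc_of% h₁']⟩
      · rintro ⟨y, hy⟩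
        exact ⟨y ≫ αY, by rw [Category.assoc, ← hi.w, reassoc_of% hy, hh.w]⟩
    · rw [reassoc_of% hi.w]
      refine (eq_verum fun T t ↦ ?_).trans (eq_verum fun T t ↦ ?_).symm
      · rw [mem_comp, mem_comp, mem_χ]
        exact ⟨_, rfl⟩
      · rw [mem_comp, mem_χ]
        exact ⟨_, rfl⟩
  refine isPullback_of_existsUnique hi.w (fun T z y e ↦ ?_) fun T p q hpq _ ↦ (cancel_mono i').1 hpq
  obtain ⟨s, hs⟩ := (mem_χ i').1 (key ▸ mem_comp.2 ((mem_χ i).2 ⟨y, e.symm⟩))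
  refine ⟨s, hs, (cancel_mono i).1 ?_⟩
  rw [Category.assoc, ← hi.w, reassoc_of% hs, e]

/-- In a cube as in `isPullback_right`, the morphisms `h'` and `αX` are jointly monic. For
generalized elements `a`, `b` of `X'` with the same images, the predicate `σ` on `x` in `X'` saying
that `x = a` implies `a = b` holds on all of `W'` and so extends to the pushout `Z'`. It holds at
`b`, hence also at `a`. -/
lemma eq_of_comp_eq [Mono f] (hf : IsPullback f' αW αX f)
    (hg : IsPullback g' αW αY g) (H' : IsPushout f' g' h' i') {T : C} {a b : T ⟶ X'}
    (e₁ : a ≫ h' = b ≫ h') (e₂ : a ≫ αX = b ≫ αX) : a = b := by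
  have := mono_fst_of_isPullback hf
  have := mono_of_isPushout H'
  let ε : T ⟶ Ω C := χ (equalizer.ι a b)
  obtain ⟨σ, hσ⟩ := exists_implication (χ (lift (𝟙 T) a)) (fst T X' ≫ ε)
  have hσ' {S : C} (s : S ⟶ T) (x : S ⟶ X') : Mem (lift s x) σ ↔
      ∀ ⦃R : C⦄ (r : R ⟶ S), r ≫ x = r ≫ s ≫ a → r ≫ s ≫ a = r ≫ s ≫ b := by
    simp only [hσ, comp_lift, mem_χ_graph, mem_comp, lift_fst, ε, mem_χ_equalizer,
      Category.assoc]
  have hfσ : T ◁ f' ≫ σ = T ◁ g' ≫ verum C _ := by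
    rw [comp_verum]
    refine eq_verum fun S t ↦ ?_
    obtain ⟨s, w, rfl⟩ : ∃ s w, t = lift s w := ⟨t ≫ fst _ _, t ≫ snd _ _, by ext <;> simp⟩
    rw [mem_comp, lift_whiskerLeft, hσ']
    intro R r hr
    obtain ⟨w', h₁, h₂⟩ := hf.exists_lift (r ≫ s ≫ b) (r ≫ w ≫ αW) (by
      simp only [Category.assoc, ← e₂, ← hf.w, reassoc_of% hr])
    have : w' = r ≫ w := by
      refine hg.hom_ext ((cancel_mono i').1 ?_) (by simp [h₂])
      simp only [Category.assoc, ← H'.w, reassoc_of% h₁, ← e₁, reassoc_of% hr]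
    rw [← hr, ← h₁, this, Category.assoc]
  obtain ⟨θ, h₁, -⟩ := exists_predicate (isPushout_whiskerLeft H' T) hfσ
  have hb : Mem (lift (𝟙 T) b) σ := (hσ' _ _).2 fun R r hr ↦ by simpa using hr.symm
  rw [← h₁, mem_comp, lift_whiskerLeft, ← e₁, ← lift_whiskerLeft, ← mem_comp, h₁, hσ'] at hb
  simpa using hb (𝟙 T) (by simp)

/-- In a cube as in `isPullback_right`, the face over `h` is a pullback: the comparison `q` from
`X'` to the pullback is monic by `eq_of_comp_eq`, and epic by stability of pushouts. -/
lemma isPullback_left (H : IsPushout f g h i) [Mono f] (hf : IsPullback f' αW αX f)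
    (hg : IsPullback g' αW αY g) (hh : CommSq h' αX αZ h) (hi : CommSq i' αY αZ i)
    (H' : IsPushout f' g' h' i') : IsPullback h' αX αZ h := by
  have hi' := isPullback_right H hf hh hi H'
  let q : X' ⟶ pullback αZ h := pullback.lift h' αX hh.w
  have hq₁ : q ≫ pullback.fst αZ h = h' := pullback.lift_fst _ _ _
  have hq₂ : q ≫ pullback.snd αZ h = αX := pullback.lift_snd _ _ _
  have hfq : IsPullback (f' ≫ q) αW (pullback.snd αZ h) f := by
    refine isPullback_of_existsUnique (by rw [Category.assoc, hq₂, hf.w]) (fun T t w e ↦ ?_)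
      fun T p p' e₁ e₂ ↦ ?_
    · obtain ⟨y, hy₁, hy₂⟩ := hi'.exists_lift (t ≫ pullback.fst αZ h) (w ≫ g) (by
        rw [Category.assoc, pullback.condition, reassoc_of% e, H.w, Category.assoc])
      obtain ⟨w', h₁, h₂⟩ := hg.exists_lift y w hy₂
      refine ⟨w', ?_, h₂⟩
      apply pullback.hom_ext
      · simp only [Category.assoc, hq₁, H'.w, reassoc_of% h₁, hy₁]
      · simp only [Category.assoc, hq₂, hf.w, reassoc_of% h₂, e]
    · have := mono_fst_of_isPullback hf
      have := mono_of_isPushout H'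
      refine hg.hom_ext ((cancel_mono i').1 ?_) e₂
      have := e₁ =≫ pullback.fst αZ h
      simpa only [Category.assoc, hq₁, H'.w] using this
  have HQ : IsPushout (f' ≫ q) g' (pullback.fst αZ h) i' :=
    isPushout_of_isPullback H hfq hg (IsPullback.of_hasPullback αZ h) hi'
      ⟨by rw [Category.assoc, hq₁, H'.w]⟩
  have : Mono q := ⟨fun a b e ↦ eq_of_comp_eq hf hg H'
    (by simpa only [Category.assoc, hq₁] using e =≫ pullback.fst αZ h)
    (by simpa only [Category.assoc, hq₂] using e =≫ pullback.snd αZ h)⟩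
  have : Epi q := epi_of_predicates fun φ hφ ↦ by
    -- By `HQ`, `Z'` is glued from `Y'` and the domain of `φ`, so `φ` extends to `Z'` by the maximal
    -- predicate on `Y'`; the extension restricts to the maximal predicate on `X'` too.
    obtain ⟨θ, h₁, h₂⟩ := exists_predicate HQ (φ := φ) (ψ := verum C Y')
      (by rw [Category.assoc, hφ, comp_verum, comp_verum])
    have hθ : θ = verum C Z' := H'.hom_ext (by rw [← hq₁, Category.assoc, h₁, hφ, comp_verum])
      (by rw [h₂, comp_verum])
    rw [← h₁, hθ, comp_verum]
  have : IsIso q := isIso_of_mono_of_epi q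
  exact IsPullback.of_iso_pullback hh (asIso q) hq₁ hq₂

end Pushout

end CategoryTheory.Topos

/-- Every elementary topos (a finitely complete, cartesian closed category with a subobject
classifier) is adhesive: pullbacks and pushouts along monomorphisms exist, and pushouts along
monomorphisms are Van Kampen squares. -/
theorem mainTheorem9 (C : Type u) [Category.{v} C] [HasFiniteLimits C]
    [CartesianMonoidalCategory C] [MonoidalClosed C] [HasSubobjectClassifier C] :
    Adhesive C := by
  constructor
  intro W X Y Z f g h i _ H W' X' Y' Z' f' g' h' i' αW αX αY αZ hf hg hh hi sq
  constructor
  · intro H'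
    exact ⟨Topos.isPullback_left H hf hg hh hi H', Topos.isPullback_right H hf hh hi H'⟩
  · rintro ⟨hh', hi'⟩
    exact Topos.isPushout_of_isPullback H hf hg hh' hi' sq
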